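/- Let $*$ be a continuous t-norm on $[0,1]$, i.e. $([0,1],*,1)$ is a commutative monoid, $*$ is monotone in both variables, and $*\colon[0,1]^2\to[0,1]$ is continuous; let $p\to r=\max\{q\mid p*q\le r\}$. A $[0,1]_*$-set is a set $X$ with a map $\alpha\colon X\times X\to[0,1]$ such that, for all $x,y,z\in X$, $\alpha(x,y)\le\alpha(x,x)\wedge\alpha(y,y)$, $\alpha(x,y)=\alpha(y,x)$ and $\alpha(y,z)*(\alpha(y,y)\to\alpha(x,y))\le\alpha(x,z)$. A morphism $(X,\alpha)\to(Y,\beta)$ is a map $\phi\colon X\times Y\to[0,1]$ such that, for all $x,x'\in X$ and $y,y'\in Y$, $$\phi(x,y)\le\alpha(x,x)\wedge\beta(y,y),\qquad (\beta(y,y)\to\beta(y,y'))*\phi(x,y)*(\alpha(x,x)\to\alpha(x',x))\le\phi(x',y'),$$ $$\phi(x,y')*(\alpha(x,x)\to\phi(x,y))\le\beta(y,y'),\qquad \alpha(x,x')\le\bigvee_{y\in Y}\phi(x',y)*(\beta(y,y)\to\phi(x,y)).$$ The composite of $\phi\colon(X,\alpha)\to(Y,\beta)$ and $\psi\colon(Y,\beta)\to(Z,\gamma)$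 is $(\psi\circ\phi)(x,z)=\bigvee_{y\in Y}\psi(y,z)*(\beta(y,y)\to\phi(x,y))$, and the identity on $(X,\alpha)$ is $\alpha$. Let $[0,1]_*\text{-}\mathbf{Set}$ be the resulting category. Then $[0,1]_*\text{-}\mathbf{Set}$ is an (elementary) topos, that is, it has finite limits, is cartesian closed and has a subobject classifier, if and only if $*$ is the minimum t-norm, i.e. $p*q=\min\{p,q\}$ for all $p,q\in[0,1]$. -/

import Mathlib

open CategoryTheory CategoryTheory.Limits

universe v u

/-- A continuous t-norm on the unit interval: a commutative monoid structure on `[0,1]` with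
unit `1` that is monotone in both variables and jointly continuous. -/
structure ContinuousTNorm where
  op : unitInterval → unitInterval → unitInterval
  op_assoc : ∀ p q r, op (op p q) r = op p (op q r)
  op_comm : ∀ p q, op p q = op q p
  one_op : ∀ p, op 1 p = p
  op_mono : ∀ {p p' q q'}, p ≤ p' → q ≤ q' → op p q ≤ op p' q'
  continuous_op : Continuous fun x : unitInterval × unitInterval => op x.1 x.2

namespace ContinuousTNorm

variable (T : ContinuousTNorm)

/-- The residuum `p → r`, the largest `q` with `p * q ≤ r`. -/
noncomputable def imp (p r : unitInterval) : unitInterval :=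
  sSup {q | T.op p q ≤ r}

/-- The t-norm is the minimum t-norm on `[0,1]`. -/
def IsMinimum : Prop := ∀ p q : unitInterval, T.op p q = min p q

instance : Std.Associative T.op := ⟨T.op_assoc⟩

instance : Std.Commutative T.op := ⟨T.op_comm⟩

theorem op_one (p : unitInterval) : T.op p 1 = p := by rw [T.op_comm, T.one_op]

theorem op_le_left (p q : unitInterval) : T.op p q ≤ p := by
  simpa only [T.op_one] using T.op_mono (le_refl p) (unitInterval.le_one' : q ≤ 1)

theorem op_le_right (p q : unitInterval) : T.op p q ≤ q := by
  rw [T.op_comm]; exact T.op_le_left q p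

theorem op_zero (p : unitInterval) : T.op p 0 = 0 :=
  le_antisymm (T.op_le_right p 0) unitInterval.nonneg'

theorem continuous_op_right (p : unitInterval) : Continuous (T.op p) :=
  T.continuous_op.comp (continuous_const.prodMk continuous_id)

theorem op_imp_le (p r : unitInterval) : T.op p (T.imp p r) ≤ r := by
  have hc : IsClosed {q | T.op p q ≤ r} :=
    isClosed_le (T.continuous_op_right p) continuous_const
  have hn : {q | T.op p q ≤ r}.Nonempty :=
    ⟨0, (T.op_zero p).le.trans unitInterval.nonneg'⟩
  exact hc.isCompact.sSup_mem hn

theorem le_imp_iff {p q r : unitInterval} : q ≤ T.imp p r ↔ T.op p q ≤ r :=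
  ⟨fun h => (T.op_mono le_rfl h).trans (T.op_imp_le p r), fun h => le_sSup h⟩

theorem gc (p : unitInterval) : GaloisConnection (T.op p) (T.imp p) :=
  fun _ _ => T.le_imp_iff.symm

theorem op_iSup {ι : Sort*} (p : unitInterval) (f : ι → unitInterval) :
    T.op p (⨆ i, f i) = ⨆ i, T.op p (f i) := (T.gc p).l_iSup

theorem iSup_op {ι : Sort*} (p : unitInterval) (f : ι → unitInterval) :
    T.op (⨆ i, f i) p = ⨆ i, T.op (f i) p := by
  rw [T.op_comm, T.op_iSup]; simp only [T.op_comm p]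

theorem imp_self (p : unitInterval) : T.imp p p = 1 :=
  le_antisymm unitInterval.le_one' (T.le_imp_iff.2 (T.op_le_left p 1))

theorem op_imp_of_le {q w : unitInterval} (h : w ≤ q) : T.op q (T.imp q w) = w := by
  have hw : w ∈ Set.Icc (T.op q 0) (T.op q 1) :=
    ⟨(T.op_zero q).le.trans unitInterval.nonneg', h.trans (T.op_one q).ge⟩
  obtain ⟨s, hs⟩ := intermediate_value_univ (0 : unitInterval) 1 (T.continuous_op_right q) hw
  refine le_antisymm (T.op_imp_le q w) ?_
  calc w = T.op q s := hs.symm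
    _ ≤ _ := T.op_mono le_rfl (T.le_imp_iff.2 hs.le)

theorem op_imp_swap {a b q : unitInterval} (ha : a ≤ q) (hb : b ≤ q) :
    T.op a (T.imp q b) = T.op (T.imp q a) b := by
  conv_lhs => rw [← T.op_imp_of_le ha]
  conv_rhs => rw [← T.op_imp_of_le hb]
  ac_rfl

theorem op_imp_le_right {a b q : unitInterval} (ha : a ≤ q) (hb : b ≤ q) :
    T.op a (T.imp q b) ≤ b := by
  rw [T.op_imp_swap ha hb]; exact T.op_le_right _ _

theorem op_imp_iSup {ι : Sort*} {a q : unitInterval} {f : ι → unitInterval} (ha : a ≤ q)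
    (hf : ∀ i, f i ≤ q) : T.op a (T.imp q (⨆ i, f i)) = ⨆ i, T.op a (T.imp q (f i)) := by
  rw [T.op_imp_swap ha (iSup_le hf), T.op_iSup]
  exact iSup_congr fun i => (T.op_imp_swap ha (hf i)).symm

theorem imp_mono_right (q : unitInterval) {a b : unitInterval} (h : a ≤ b) :
    T.imp q a ≤ T.imp q b := T.le_imp_iff.2 ((T.op_imp_le q a).trans h)

/-- Adding a scalar inside a residuum. -/
theorem op_imp_le_imp_op (a q b : unitInterval) : T.op a (T.imp q b) ≤ T.imp q (T.op a b) := by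
  rw [T.le_imp_iff]
  calc T.op q (T.op a (T.imp q b)) = T.op a (T.op q (T.imp q b)) := by ac_rfl
    _ ≤ _ := T.op_mono le_rfl (T.op_imp_le q b)

end ContinuousTNorm

/-- A `[0,1]_*`-set: a set with a `[0,1]_*`-valued equality `α`. -/
structure TNormSet (T : ContinuousTNorm) : Type (u + 1) where
  carrier : Type u
  α : carrier → carrier → unitInterval
  le_min : ∀ x y, α x y ≤ min (α x x) (α y y)
  symm : ∀ x y, α x y = α y x
  trans : ∀ x y z, T.op (α y z) (T.imp (α y y) (α x y)) ≤ α x z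

namespace TNormSet

variable {T : ContinuousTNorm}

theorem le_left (X : TNormSet.{u} T) (x y : X.carrier) : X.α x y ≤ X.α x x :=
  (X.le_min x y).trans (min_le_left _ _)

theorem le_right (X : TNormSet.{u} T) (x y : X.carrier) : X.α x y ≤ X.α y y :=
  (X.le_min x y).trans (min_le_right _ _)

/-- A morphism of `[0,1]_*`-sets. -/
@[ext]
structure Hom (X Y : TNormSet.{u} T) : Type u where
  rel : X.carrier → Y.carrier → unitInterval
  rel_le_min : ∀ x y, rel x y ≤ min (X.α x x) (Y.α y y)
  rel_compat : ∀ x x' y y',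
    T.op (T.op (T.imp (Y.α y y) (Y.α y y')) (rel x y)) (T.imp (X.α x x) (X.α x' x)) ≤ rel x' y'
  rel_single : ∀ x y y', T.op (rel x y') (T.imp (X.α x x) (rel x y)) ≤ Y.α y y'
  rel_total : ∀ x x', X.α x x' ≤ ⨆ y, T.op (rel x' y) (T.imp (Y.α y y) (rel x y))

namespace Hom

variable {X Y Z W : TNormSet.{u} T}

theorem rel_le_left (f : Hom X Y) (x : X.carrier) (y : Y.carrier) : f.rel x y ≤ X.α x x :=
  (f.rel_le_min x y).trans (min_le_left _ _)

theorem rel_le_right (f : Hom X Y) (x : X.carrier) (y : Y.carrier) : f.rel x y ≤ Y.α y y :=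
  (f.rel_le_min x y).trans (min_le_right _ _)

theorem rel_compat_left (f : Hom X Y) (x x' : X.carrier) (y : Y.carrier) :
    T.op (f.rel x y) (T.imp (X.α x x) (X.α x' x)) ≤ f.rel x' y := by
  simpa only [T.imp_self, T.one_op] using f.rel_compat x x' y y

theorem rel_compat_right (f : Hom X Y) (x : X.carrier) (y y' : Y.carrier) :
    T.op (T.imp (Y.α y y) (Y.α y y')) (f.rel x y) ≤ f.rel x y' := by
  simpa only [T.imp_self, T.op_one] using f.rel_compat x x y y'

/-- The identity morphism of `(X, α)` is `α` itself. -/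
def id (X : TNormSet.{u} T) : Hom X X where
  rel := X.α
  rel_le_min := X.le_min
  rel_compat x x' y y' := by
    have h1 : T.op (T.imp (X.α y y) (X.α y y')) (X.α x y) ≤ X.α x y' := by
      rw [← T.op_imp_swap (X.le_left y y') (X.le_right x y)]
      exact X.trans x y y'
    exact (T.op_mono h1 le_rfl).trans (X.trans x' x y')
  rel_single x y y' := by
    rw [X.symm x y]
    exact X.trans y x y'
  rel_total x x' := by
    refine le_trans ?_ (le_iSup _ x')
    rw [T.op_imp_of_le (X.le_right x x')]

/-- Composition of morphisms of `[0,1]_*`-sets (in diagrammatic order). -/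
noncomputable def comp (f : Hom X Y) (g : Hom Y Z) : Hom X Z where
  rel x z := ⨆ y, T.op (g.rel y z) (T.imp (Y.α y y) (f.rel x y))
  rel_le_min x z := iSup_le fun y => _root_.le_min
    ((T.op_imp_le_right (g.rel_le_left y z) (f.rel_le_right x y)).trans (f.rel_le_left x y))
    ((T.op_le_left _ _).trans (g.rel_le_right y z))
  rel_compat x x' z z' := by
    rw [T.op_iSup, T.iSup_op]
    refine iSup_mono fun y => ?_
    calc
      T.op (T.op (T.imp (Z.α z z) (Z.α z z')) (T.op (g.rel y z) (T.imp (Y.α y y) (f.rel x y))))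
          (T.imp (X.α x x) (X.α x' x))
        = T.op (T.op (T.imp (Z.α z z) (Z.α z z')) (g.rel y z))
          (T.op (T.imp (X.α x x) (X.α x' x)) (T.imp (Y.α y y) (f.rel x y))) := by ac_rfl
      _ ≤ T.op (g.rel y z') (T.imp (Y.α y y) (f.rel x' y)) := by
        refine T.op_mono (g.rel_compat_right y z z') ((T.op_imp_le_imp_op _ _ _).trans ?_)
        refine T.imp_mono_right _ ?_
        rw [T.op_comm]
        exact f.rel_compat_left x x' y
  rel_single x z z' := by
    have hle : ∀ y z, T.op (g.rel y z) (T.imp (Y.α y y) (f.rel x y)) ≤ f.rel x y := fun y z =>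
      T.op_imp_le_right (g.rel_le_left y z) (f.rel_le_right x y)
    rw [T.iSup_op]
    refine iSup_le fun y' => ?_
    rw [T.op_imp_iSup ((hle y' z').trans (f.rel_le_left x y'))
      fun y => (hle y z).trans (f.rel_le_left x y)]
    refine iSup_le fun y => ?_
    have e1 := T.op_imp_swap (g.rel_le_left y' z') (f.rel_le_right x y')
    have e2 := T.op_imp_swap (g.rel_le_left y z) (f.rel_le_right x y)
    have e3 := T.op_imp_swap (f.rel_le_left x y') ((hle y z).trans (f.rel_le_left x y))
    have e4 := T.op_imp_swap (f.rel_le_left x y') (f.rel_le_left x y)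
    have e5 := T.op_imp_swap (g.rel_le_left y' z') (Y.le_right y y')
    calc
      T.op (T.op (g.rel y' z') (T.imp (Y.α y' y') (f.rel x y')))
          (T.imp (X.α x x) (T.op (g.rel y z) (T.imp (Y.α y y) (f.rel x y))))
        = T.op (T.imp (Y.α y' y') (g.rel y' z')) (T.op (f.rel x y')
          (T.imp (X.α x x) (T.op (g.rel y z) (T.imp (Y.α y y) (f.rel x y))))) := by
          rw [e1]; ac_rfl
      _ = T.op (T.imp (Y.α y' y') (g.rel y' z')) (T.op (T.imp (Y.α y y) (g.rel y z))
          (T.op (f.rel x y') (T.imp (X.α x x) (f.rel x y)))) := by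
          rw [e3, e2, e4]; ac_rfl
      _ ≤ T.op (T.imp (Y.α y' y') (g.rel y' z')) (T.op (T.imp (Y.α y y) (g.rel y z))
          (Y.α y y')) := T.op_mono le_rfl (T.op_mono le_rfl (f.rel_single x y y'))
      _ = T.op (T.op (T.imp (Y.α y' y') (g.rel y' z')) (Y.α y y'))
          (T.imp (Y.α y y) (g.rel y z)) := by ac_rfl
      _ ≤ T.op (g.rel y z') (T.imp (Y.α y y) (g.rel y z)) := by
          rw [← e5]; exact T.op_mono (g.rel_compat_left y' y z') le_rfl
      _ ≤ Z.α z z' := g.rel_single y z z'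
  rel_total x x' := by
    refine (f.rel_total x x').trans (iSup_le fun y => ?_)
    have e : T.op (f.rel x' y) (T.imp (Y.α y y) (f.rel x y)) =
        T.op (Y.α y y) (T.op (T.imp (Y.α y y) (f.rel x' y)) (T.imp (Y.α y y) (f.rel x y))) := by
      conv_lhs => rw [← T.op_imp_of_le (f.rel_le_right x' y)]
      ac_rfl
    rw [e]
    refine (T.op_mono (g.rel_total y y) le_rfl).trans ?_
    rw [T.iSup_op]
    refine iSup_mono fun z => ?_
    calc
      T.op (T.op (g.rel y z) (T.imp (Z.α z z) (g.rel y z)))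
          (T.op (T.imp (Y.α y y) (f.rel x' y)) (T.imp (Y.α y y) (f.rel x y)))
        = T.op (T.op (g.rel y z) (T.imp (Y.α y y) (f.rel x' y)))
          (T.op (T.imp (Y.α y y) (f.rel x y)) (T.imp (Z.α z z) (g.rel y z))) := by ac_rfl
      _ ≤ _ := by
        refine T.op_mono (le_iSup (fun y => T.op (g.rel y z) (T.imp (Y.α y y) (f.rel x' y))) y)
          ((T.op_imp_le_imp_op _ _ _).trans (T.imp_mono_right _ ?_))
        rw [T.op_comm]
        exact le_iSup (fun y => T.op (g.rel y z) (T.imp (Y.α y y) (f.rel x y))) y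

theorem id_comp (f : Hom X Y) : comp (id X) f = f := by
  ext1; funext x y
  refine le_antisymm (iSup_le fun x' => f.rel_compat_left x' x y) ?_
  refine le_trans ?_ (le_iSup (fun x' => T.op (f.rel x' y) (T.imp (X.α x' x') (X.α x x'))) x)
  rw [T.imp_self, T.op_one]

theorem comp_id (f : Hom X Y) : comp f (id Y) = f := by
  ext1; funext x y
  refine le_antisymm (iSup_le fun y' => ?_) ?_
  · exact (T.op_imp_swap (Y.le_left y' y) (f.rel_le_right x y')).le.trans
      (f.rel_compat_right x y' y)
  · refine le_trans ?_ (le_iSup (fun y' => T.op (Y.α y' y) (T.imp (Y.α y' y') (f.rel x y'))) y)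
    rw [T.op_imp_of_le (f.rel_le_right x y)]

theorem assoc (f : Hom X Y) (g : Hom Y Z) (h : Hom Z W) :
    comp (comp f g) h = comp f (comp g h) := by
  ext1; funext x w
  have hle : ∀ y z, T.op (g.rel y z) (T.imp (Y.α y y) (f.rel x y)) ≤ Z.α z z := fun y z =>
    (T.op_le_left _ _).trans (g.rel_le_right y z)
  have hL : (comp (comp f g) h).rel x w = ⨆ z, ⨆ y,
      T.op (h.rel z w) (T.imp (Z.α z z) (T.op (g.rel y z) (T.imp (Y.α y y) (f.rel x y)))) :=
    iSup_congr fun z => T.op_imp_iSup (h.rel_le_left z w) fun y => hle y z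
  have hR : (comp f (comp g h)).rel x w = ⨆ y, ⨆ z,
      T.op (T.op (h.rel z w) (T.imp (Z.α z z) (g.rel y z))) (T.imp (Y.α y y) (f.rel x y)) :=
    iSup_congr fun y => T.iSup_op _ _
  rw [hL, hR, iSup_comm]
  refine iSup_congr fun y => iSup_congr fun z => ?_
  rw [T.op_imp_swap (h.rel_le_left z w) (hle y z),
    T.op_imp_swap (h.rel_le_left z w) (g.rel_le_right y z)]
  ac_rfl

end Hom

/-- The category `[0,1]_*-Set`. -/
noncomputable instance : Category.{u} (TNormSet.{u} T) where
  Hom := Hom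
  id := Hom.id
  comp := Hom.comp
  id_comp := Hom.id_comp
  comp_id := Hom.comp_id
  assoc := Hom.assoc

end TNormSet

/-- An (elementary) topos: a category with finite limits which is cartesian closed (every
functor `- ⨯ Y` has a right adjoint) and has a subobject classifier. -/
structure IsTopos (C : Type u) [Category.{v} C] : Prop where
  hasFiniteLimits : HasFiniteLimits C
  exponentiable : ∀ Y : C, (prod.functor.flip.obj Y).IsLeftAdjoint
  hasSubobjectClassifier : HasSubobjectClassifier C

/-! A subobject classifier makes a category balanced, so for the forward direction it is enough to
exhibit, for any other t-norm, a morphism that is mono and epi but not invertible. If `*` is not the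
minimum, some p is not idempotent; let e be the greatest idempotent below p and choose e < r < p.
Take two points of extent p, equal to degree e in the source and to degree r in the target, and the
morphism given by the identity relation of the target. It is always epi and never invertible. It is
mono because a morphism into the source has little freedom (`eq_or_idempotent`,
`twoPoint_rel_cases`): at an element of extent p it picks one of the points, and at every other
element the extent is an idempotent at most e, too small to tell the points apart.

Conversely, if `*` is the minimum, then a * (q → b) = min a b whenever a, b ≤ q. The axioms then say
that for each r the relation r < α is a partial equivalence relation and that the relations r < φ
are functional; strict inequalities are used because r < ⨆ holds exactly when r lies below some
term. The constructions of Heyting-valued sets can then be checked level by level as for ordinary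
sets. The exponential consists of functional relations defined up to some degree, and the truth
values are the numbers in [0,1]. -/

namespace ContinuousTNorm

/-! ### Idempotents of a continuous t-norm -/

variable {T : ContinuousTNorm}

theorem isMinimum_of_idempotent (h : ∀ p, T.op p p = p) : T.IsMinimum := by
  intro p q
  refine le_antisymm (_root_.le_min (T.op_le_left p q) (T.op_le_right p q)) ?_
  calc min p q = T.op (min p q) (min p q) := (h _).symm
    _ ≤ T.op p q := T.op_mono (min_le_left _ _) (min_le_right _ _)

/-- By continuity p is a multiple of f, and the idempotent f is absorbed. -/
theorem op_eq_left_of_le {p f : unitInterval} (hf : T.op f f = f) (h : p ≤ f) :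
    T.op p f = p := by
  rw [← T.op_imp_of_le h, T.op_comm f, T.op_assoc, hf]

/-- The extents `c ≤ p` that admit a one-point morphism into `p` are `p` and idempotents. -/
theorem eq_or_idempotent {p c : unitInterval} (hc : c ≤ p) (h : c ≤ T.op c (T.imp p c)) :
    c = p ∨ T.op c c = c := by
  refine or_iff_not_imp_left.2 fun hne => ?_
  have hcl : IsClosed {x | c ≤ T.op c x} := isClosed_le continuous_const (T.continuous_op_right c)
  -- The infimum f is itself a solution of c ≤ c * x, by compactness. Then c ≤ c * f ≤ c * (f * f),
  -- so minimality makes f idempotent.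
  have hf : c ≤ T.op c (sInf {x | c ≤ T.op c x}) := hcl.isCompact.sInf_mem ⟨_, h⟩
  set f := sInf {x | c ≤ T.op c x}
  have hff : T.op f f = f := by
    refine le_antisymm (T.op_le_left f f) (sInf_le ?_)
    rw [Set.mem_ofPred_eq, ← T.op_assoc]
    exact hf.trans (T.op_mono hf le_rfl)
  have hcf : c ≤ f := hf.trans (T.op_le_right c f)
  have hfs : f ≤ T.imp p c := sInf_le h
  have hfp : T.op p f ≤ c := T.le_imp_iff.1 hfs
  -- If p ≤ f, then p = p * f ≤ c, so c = p. Otherwise f = f * f ≤ p * f ≤ c ≤ f, so c is the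
  -- idempotent f.
  have hlt : f ≤ p := by
    by_contra hcon
    rw [op_eq_left_of_le hff (not_le.1 hcon).le] at hfp
    exact hne (le_antisymm hc hfp)
  have : f ≤ c := by
    calc f = T.op f f := hff.symm
      _ ≤ T.op p f := T.op_mono hlt le_rfl
      _ ≤ c := hfp
  rw [le_antisymm hcf this]
  exact hff

theorem exists_greatest_idempotent (p : unitInterval) :
    ∃ e, e ≤ p ∧ T.op e e = e ∧ ∀ c, c ≤ p → T.op c c = c → c ≤ e := by
  have hcl : IsClosed {c | c ≤ p ∧ T.op c c = c} :=
    (isClosed_le continuous_id continuous_const).inter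
      (isClosed_eq (T.continuous_op.comp (continuous_id.prodMk continuous_id)) continuous_id)
  have h := hcl.isCompact.sSup_mem ⟨0, unitInterval.nonneg', T.op_zero 0⟩
  exact ⟨_, h.1, h.2, fun c h1 h2 => le_sSup ⟨h1, h2⟩⟩

end ContinuousTNorm

/-! ### A bimorphism between two-point objects -/

namespace TNormSet

variable {T : ContinuousTNorm}

theorem Hom.ext_rel {X Y : TNormSet.{u} T} {f g : X ⟶ Y}
    (h : ∀ x y, f.rel x y = g.rel x y) : f = g :=
  Hom.ext (funext fun x => funext fun y => h x y)

/-- The equality on a pair of elements of extent `p` which are equal to the degree `r`. -/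
def pairDegree (p r : unitInterval) (x y : ULift.{u} Bool) : unitInterval := if x = y then p else r

@[simp] theorem pairDegree_self (p r : unitInterval) (x : ULift.{u} Bool) :
    pairDegree p r x x = p := if_pos rfl

theorem pairDegree_of_ne (p r : unitInterval) {x y : ULift.{u} Bool} (h : x ≠ y) :
    pairDegree p r x y = r := if_neg h

theorem pairDegree_le {p r : unitInterval} (h : r ≤ p) (x y : ULift.{u} Bool) :
    pairDegree p r x y ≤ p := by
  unfold pairDegree; split_ifs; exacts [le_rfl, h]

theorem le_pairDegree {p r : unitInterval} (h : r ≤ p) (x y : ULift.{u} Bool) :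
    r ≤ pairDegree p r x y := by
  unfold pairDegree; split_ifs; exacts [h, le_rfl]

theorem pairDegree_mono (p : unitInterval) {r r' : unitInterval} (h : r ≤ r')
    (x y : ULift.{u} Bool) : pairDegree p r x y ≤ pairDegree p r' x y := by
  unfold pairDegree; split_ifs; exacts [le_rfl, h]

variable (T) in
/-- Two elements of extent `p` which are equal to the degree `r`. -/
abbrev twoPoint (p r : unitInterval) (h : r ≤ p) : TNormSet.{u} T where
  carrier := ULift Bool
  α := pairDegree p r
  le_min x y := by
    simpa only [pairDegree_self, min_self] using pairDegree_le h x y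
  symm x y := by simp only [pairDegree, eq_comm]
  trans x y z := by
    rw [pairDegree_self]
    by_cases h1 : y = z
    · subst h1
      rw [pairDegree_self]
      exact T.op_imp_le _ _
    by_cases h2 : x = y
    · subst h2
      exact T.op_le_left _ _
    have : x = z := by
      obtain ⟨x⟩ := x; obtain ⟨y⟩ := y; obtain ⟨z⟩ := z
      cases x <;> cases y <;> cases z <;> simp_all
    rw [this, pairDegree_self]
    exact (T.op_le_left _ _).trans (pairDegree_le h y z)

section twoPoint

variable {p r r' : unitInterval}

/-- Relaxing the equality between the two points. -/
def twoPointRelax (h : r ≤ r') (h' : r' ≤ p) :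
    twoPoint.{u} T p r (h.trans h') ⟶ twoPoint.{u} T p r' h' :=
  -- The relation is the identity of the target, so the axioms follow from those of `Hom.id`; the
  -- smaller source equality only weakens what is required.
  { rel := pairDegree p r'
    rel_le_min := fun x y => by
      simpa only [pairDegree_self, min_self] using pairDegree_le h' x y
    rel_compat := fun x x' y y' => by
      have := (Hom.id (twoPoint.{u} T p r' h')).rel_compat x x' y y'
      refine le_trans (T.op_mono le_rfl ?_) this
      simpa only [pairDegree_self] using T.imp_mono_right p (pairDegree_mono p h x' x)
    rel_single := fun x y y' => by
      have := (Hom.id (twoPoint.{u} T p r' h')).rel_single x y y'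
      refine le_trans (T.op_mono le_rfl ?_) this
      simp only [pairDegree_self]
      exact le_rfl
    rel_total := fun x x' =>
      (pairDegree_mono p h x x').trans ((Hom.id (twoPoint.{u} T p r' h')).rel_total x x') }

/-- The composition formula involves the equality of the middle object only, so this is the left
unit law for k. Cancellation on the left is then immediate. -/
theorem twoPointRelax_comp_rel (h : r ≤ r') (h' : r' ≤ p) {Z : TNormSet.{u} T}
    (k : twoPoint.{u} T p r' h' ⟶ Z) (x : ULift Bool) (z : Z.carrier) :
    (twoPointRelax h h' ≫ k).rel x z = k.rel x z :=
  congrFun (congrFun (congrArg Hom.rel (Hom.id_comp k)) x) z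

theorem epi_twoPointRelax (h : r ≤ r') (h' : r' ≤ p) :
    Epi (twoPointRelax.{u} (T := T) h h') where
  left_cancellation k l hkl := Hom.ext_rel fun x z => by
    rw [← twoPointRelax_comp_rel h h', hkl, twoPointRelax_comp_rel]

/-- An inverse would have the identity of the source as its relation, and its compatibility with the
target equality would read r' = p * (p → r') ≤ r. -/
theorem not_isIso_twoPointRelax (h : r < r') (h' : r' ≤ p) :
    ¬ IsIso (twoPointRelax.{u} (T := T) h.le h') := by
  intro hi
  have hk : ∀ x z, (inv (twoPointRelax.{u} (T := T) h.le h')).rel x z =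
      pairDegree p r x z := fun x z => by
    rw [← twoPointRelax_comp_rel h.le h', IsIso.hom_inv_id]
    rfl
  have := (inv (twoPointRelax.{u} (T := T) h.le h')).rel_compat_left ⟨true⟩ ⟨false⟩ ⟨true⟩
  rw [hk, hk] at this
  dsimp only at this
  rw [pairDegree_self, pairDegree_self, pairDegree_of_ne _ _ (by simp),
    pairDegree_of_ne _ _ (by simp), T.op_imp_of_le h'] at this
  exact not_lt_of_ge this h

/-- Morphisms into a two-point object, when `r` is the greatest idempotent below `p`. -/
theorem twoPoint_rel_cases {h : r ≤ p}
    (hmax : ∀ c, c ≤ p → T.op c c = c → c ≤ r) {Z : TNormSet.{u} T}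
    (g : Z ⟶ twoPoint.{u} T p r h) (z : Z.carrier) :
    (T.op (Z.α z z) (Z.α z z) = Z.α z z ∧ ∀ x, g.rel z x = Z.α z z) ∨
      (Z.α z z = p ∧ ∃ x, ∀ x', g.rel z x' = pairDegree p r x x') := by
  -- A supremum over two points is attained, so a single x witnesses totality. Its value must be the
  -- whole extent of z, to which `eq_or_idempotent` applies.
  obtain ⟨x, hx⟩ : ∃ x, Z.α z z ≤ T.op (g.rel z x) (T.imp p (g.rel z x)) := by
    have h1 := g.rel_total z z
    obtain ⟨x, hx⟩ := exists_eq_ciSup_of_finite (ι := ULift Bool) (f := fun x =>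
      T.op (g.rel z x) (T.imp (pairDegree p r x x) (g.rel z x)))
    have h2 := h1.trans hx.ge
    rw [pairDegree_self] at h2
    exact ⟨x, h2⟩
  have hgc : g.rel z x = Z.α z z := le_antisymm (g.rel_le_left z x) (hx.trans (T.op_le_left _ _))
  have hgp : ∀ x, g.rel z x ≤ p := fun x => by
    simpa only [pairDegree_self] using g.rel_le_right z x
  have hcompat : ∀ x', T.op (T.imp p (pairDegree p r x x')) (g.rel z x) ≤
      g.rel z x' := fun x' => by
    simpa only [pairDegree_self] using g.rel_compat_right z x x'
  have hcp := hgp x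
  rw [hgc] at hx hcp
  rcases ContinuousTNorm.eq_or_idempotent hcp hx with hc | hc
  · refine Or.inr ⟨hc, x, fun x' => le_antisymm ?_ ?_⟩
    · have := g.rel_single z x x'
      rwa [hgc, T.imp_self, T.op_one] at this
    · refine le_trans ?_ (hcompat x')
      rw [hgc, hc, T.op_comm, T.op_imp_of_le]
      exact pairDegree_le h x x'
  · refine Or.inl ⟨hc, fun x' => le_antisymm (g.rel_le_left z x') ?_⟩
    refine le_trans ?_ (hcompat x')
    have hcr := hmax _ hcp hc
    -- An idempotent extent is at most r, hence below both entries of `pairDegree p r`, and so it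
    -- cannot separate the points.
    have : Z.α z z ≤ T.imp p (pairDegree p r x x') := by
      refine T.le_imp_iff.2 ((T.op_le_right _ _).trans (hcr.trans (le_pairDegree h x x')))
    rw [hgc]
    exact hc.ge.trans (T.op_mono this le_rfl)

theorem mono_twoPointRelax (h : r ≤ r') (h' : r' < p) 
    (hmax : ∀ c, c ≤ p → T.op c c = c → c ≤ r) :
    Mono (twoPointRelax.{u} (T := T) h h'.le) where
  right_cancellation {Z} g k hgk := by
    -- Extent p is not idempotent, so the two cases of `twoPoint_rel_cases` exclude each other and
    -- both morphisms fall into the same one.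
    have hp : T.op p p ≠ p := fun hp => not_lt_of_ge (hmax p le_rfl hp) (h.trans_lt h')
    have key : ∀ (g k : Z ⟶ twoPoint.{u} T p r (h.trans h'.le)), g ≫ twoPointRelax h h'.le =
        k ≫ twoPointRelax h h'.le → ∀ z, Z.α z z = p → ∀ x y : ULift Bool,
        (∀ x', g.rel z x' = pairDegree p r x x') →
        (∀ x', k.rel z x' = pairDegree p r y x') → x = y := by
      intro g k hgk z hz x y hx hy
      by_contra hxy
      -- After relaxing, the chosen point still has value p, while the other has value at most r' <
      -- p.
      have h1 : p ≤ (g ≫ twoPointRelax h h'.le).rel z x := by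
        refine le_trans ?_ (le_iSup (fun x' => T.op ((twoPointRelax.{u} (T := T) h h'.le).rel x' x)
          (T.imp (pairDegree p r x' x') (g.rel z x'))) x)
        simp only [hx, T.imp_self, T.op_one]
        exact (pairDegree_self p r' x).ge
      have h2 : (k ≫ twoPointRelax h h'.le).rel z x ≤ r' := by
        refine iSup_le fun x' => ?_
        rw [hy]
        change T.op (pairDegree p r' x' x) _ ≤ r'
        by_cases hxx : x' = x
        · subst hxx
          dsimp only
          rw [pairDegree_of_ne _ _ (Ne.symm hxy), pairDegree_self, pairDegree_self,
            T.op_imp_of_le (h.trans h'.le)]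
          exact h
        · rw [pairDegree_of_ne _ _ hxx]
          exact T.op_le_left _ _
      rw [hgk] at h1
      exact not_lt_of_ge (h1.trans h2) h'
    refine Hom.ext_rel fun z => ?_
    rcases twoPoint_rel_cases hmax g z with ⟨hz, hg⟩ | ⟨hz, x, hg⟩ <;>
      rcases twoPoint_rel_cases hmax k z with ⟨hz', hk⟩ | ⟨hz', y, hk⟩
    · intro x; rw [hg, hk]
    · rw [hz'] at hz; exact absurd hz hp
    · rw [hz] at hz'; exact absurd hz' hp
    · obtain rfl := key g k hgk z hz x y hg hk
      intro x; rw [hg, hk]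

end twoPoint

theorem isMinimum_of_balanced [Balanced (TNormSet.{u} T)] : T.IsMinimum := by
  refine ContinuousTNorm.isMinimum_of_idempotent fun p => ?_
  obtain ⟨e, hep, he, hmax⟩ := ContinuousTNorm.exists_greatest_idempotent (T := T) p
  rcases hep.eq_or_lt with rfl | hlt
  · exact he
  obtain ⟨r, her, hrp⟩ := exists_between hlt
  have := epi_twoPointRelax.{u} (T := T) her.le hrp.le
  have := mono_twoPointRelax.{u} her.le hrp hmax
  exact absurd (isIso_of_mono_of_epi _) (not_isIso_twoPointRelax.{u} (T := T) her hrp.le)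

end TNormSet

/-- With a subobject classifier every monomorphism is an equalizer, so a mono that is epi is
invertible. -/
theorem IsTopos.isMinimum {T : ContinuousTNorm} (h : IsTopos (TNormSet.{u} T)) : T.IsMinimum := by
  have := h.hasSubobjectClassifier
  exact TNormSet.isMinimum_of_balanced.{u}

/-! ### Strict level sets for the minimum t-norm -/

namespace ContinuousTNorm.IsMinimum

variable {T : ContinuousTNorm}

/-- The reference extent q drops out, so the products occurring in the axioms become meets. -/
theorem op_imp_eq_min (hT : T.IsMinimum) {a b q : unitInterval} (ha : a ≤ q) (hb : b ≤ q) :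
    T.op a (T.imp q b) = min a b := by
  refine le_antisymm (_root_.le_min (T.op_le_left _ _) (T.op_imp_le_right ha hb)) ?_
  rw [hT]
  refine _root_.le_min (min_le_left _ _) (T.le_imp_iff.2 ?_)
  rw [hT]
  exact (min_le_right _ _).trans (min_le_right _ _)

theorem lt_op_imp_iff (hT : T.IsMinimum) {a b q r : unitInterval} (ha : a ≤ q)
    (hb : b ≤ q) :
    r < T.op a (T.imp q b) ↔ r < a ∧ r < b := by
  rw [hT.op_imp_eq_min ha hb, lt_min_iff]

end ContinuousTNorm.IsMinimum

namespace TNormSet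

variable {T : ContinuousTNorm}

theorem lt_symm (X : TNormSet.{u} T) {r : unitInterval} {x y : X.carrier} (h : r < X.α x y) :
    r < X.α y x := by rwa [X.symm]

theorem lt_left (X : TNormSet.{u} T) {r : unitInterval} {x y : X.carrier} (h : r < X.α x y) :
    r < X.α x x := h.trans_le (X.le_left x y)

theorem lt_right (X : TNormSet.{u} T) {r : unitInterval} {x y : X.carrier} (h : r < X.α x y) :
    r < X.α y y := h.trans_le (X.le_right x y)

theorem lt_trans (hT : T.IsMinimum) (X : TNormSet.{u} T) {r : unitInterval} {x y z : X.carrier}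
    (h : r < X.α x y) (h' : r < X.α y z) : r < X.α x z :=
  ((hT.lt_op_imp_iff (X.le_left y z) (X.le_right x y)).2 ⟨h', h⟩).trans_le (X.trans x y z)

namespace Hom

variable {X Y : TNormSet.{u} T} (f : X ⟶ Y) {r : unitInterval} {x x' : X.carrier}
  {y y' : Y.carrier}

theorem lt_left (h : r < f.rel x y) : r < X.α x x := h.trans_le (f.rel_le_left x y)

theorem lt_right (h : r < f.rel x y) : r < Y.α y y := h.trans_le (f.rel_le_right x y)

theorem lt_compat_left (hT : T.IsMinimum) (h : r < f.rel x y) (hx : r < X.α x x') :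
    r < f.rel x' y :=
  ((hT.lt_op_imp_iff (f.rel_le_left x y) (X.le_right x' x)).2 ⟨h, X.lt_symm hx⟩).trans_le
    (f.rel_compat_left x x' y)

theorem lt_compat_right (hT : T.IsMinimum) (h : r < f.rel x y) (hy : r < Y.α y y') :
    r < f.rel x y' := by
  refine lt_of_lt_of_le ?_ (f.rel_compat_right x y y')
  rw [T.op_comm]
  exact (hT.lt_op_imp_iff (f.rel_le_right x y) (Y.le_left y y')).2 ⟨h, hy⟩

theorem lt_single (hT : T.IsMinimum) (h : r < f.rel x y) (h' : r < f.rel x y') : r < Y.α y y' :=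
  ((hT.lt_op_imp_iff (f.rel_le_left x y') (f.rel_le_left x y)).2 ⟨h', h⟩).trans_le
    (f.rel_single x y y')

theorem lt_total (h : r < X.α x x) : ∃ y, r < f.rel x y := by
  obtain ⟨y, hy⟩ := lt_iSup_iff.1 (h.trans_le (f.rel_total x x))
  exact ⟨y, hy.trans_le (T.op_le_left _ _)⟩

theorem lt_comp_iff (hT : T.IsMinimum) {Z : TNormSet.{u} T} (g : Y ⟶ Z) {z : Z.carrier} :
    r < (f ≫ g).rel x z ↔ ∃ y, r < f.rel x y ∧ r < g.rel y z := by
  refine lt_iSup_iff.trans (exists_congr fun y => ?_)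
  rw [hT.lt_op_imp_iff (g.rel_le_left y z) (f.rel_le_right x y), and_comm]

variable {f} in
/-- Comparable functional relations are equal. -/
theorem ext_of_lt (hT : T.IsMinimum) {g : X ⟶ Y}
    (h : ∀ r x y, r < f.rel x y → r < g.rel x y) : f = g := by
  refine ext_rel fun x y => le_antisymm (le_of_forall_lt fun r => h r x y)
    (le_of_forall_lt fun r hr => ?_)
  -- A total relation contained in a single-valued one equals it: the value y' of f is also a value
  -- of g, hence equal to y at level r.
  obtain ⟨y', hy'⟩ := f.lt_total (g.lt_left hr)
  exact f.lt_compat_right hT hy' (g.lt_single hT (h _ _ _ hy') hr)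

end Hom

/-- For the minimum t-norm, a `[0,1]_*`-set amounts to a degree of equality all of whose strict
upper level sets are symmetric and transitive. -/
abbrev ofLevels (hT : T.IsMinimum) (C : Type u) (α : C → C → unitInterval)
    (symm : ∀ x y, α x y = α y x)
    (trans : ∀ r x y z, r < α x y → r < α y z → r < α x z) : TNormSet.{u} T :=
  have le_left : ∀ x y, α x y ≤ α x x := fun x y => le_of_forall_lt fun r hr =>
    trans r x y x hr (by rwa [symm])
  have le_right : ∀ x y, α x y ≤ α y y := fun x y => (symm x y).trans_le (le_left y x)
  { carrier := C
    α := α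
    le_min := fun x y => _root_.le_min (le_left x y) (le_right x y)
    symm := symm
    trans := fun x y z => le_of_forall_lt fun r hr =>
      have h := (hT.lt_op_imp_iff (le_left y z) (le_right x y)).1 hr
      trans r x y z h.2 h.1 }

/-- For the minimum t-norm, a morphism amounts to a relation all of whose strict upper level sets
are functional relations. -/
abbrev Hom.ofLevels (hT : T.IsMinimum) {X Y : TNormSet.{u} T}
    (rel : X.carrier → Y.carrier → unitInterval)
    (left : ∀ r x y, r < rel x y → r < X.α x x)
    (compat_left : ∀ r x x' y, r < rel x y → r < X.α x x' → r < rel x' y)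
    (compat_right : ∀ r x y y', r < rel x y → r < Y.α y y' → r < rel x y')
    (single : ∀ r x y y', r < rel x y → r < rel x y' → r < Y.α y y')
    (total : ∀ r x, r < X.α x x → ∃ y, r < rel x y) : X ⟶ Y :=
  have le_left : ∀ x y, rel x y ≤ X.α x x := fun x y => le_of_forall_lt fun r => left r x y
  have le_right : ∀ x y, rel x y ≤ Y.α y y := fun x y => le_of_forall_lt fun r hr =>
    single r x y y hr hr
  { rel := rel
    rel_le_min := fun x y => _root_.le_min (le_left x y) (le_right x y)
    rel_compat := fun x x' y y' => le_of_forall_lt fun r hr => by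
      -- The triple product lies below each of two products to which `lt_op_imp_iff` applies, one
      -- for each variable.
      have h2 : r < T.op (rel x y) (T.imp (X.α x x) (X.α x' x)) :=
        hr.trans_le (T.op_mono (T.op_le_right _ _) le_rfl)
      rw [hT.lt_op_imp_iff (le_left x y) (X.le_right x' x)] at h2
      have h3 : r < T.op (rel x y) (T.imp (Y.α y y) (Y.α y y')) := by
        rw [T.op_comm (rel x y)]
        exact hr.trans_le (T.op_le_left _ _)
      rw [hT.lt_op_imp_iff (le_right x y) (Y.le_left y y')] at h3
      exact compat_left r x x' y' (compat_right r x y y' h2.1 h3.2) (X.lt_symm h2.2)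
    rel_single := fun x y y' => le_of_forall_lt fun r hr =>
      have h := (hT.lt_op_imp_iff (le_left x y') (le_left x y)).1 hr
      single r x y y' h.2 h.1
    rel_total := fun x x' => le_of_forall_lt fun r hr => by
      obtain ⟨y, hy⟩ := total r x (X.lt_left hr)
      refine lt_iSup_iff.2 ⟨y, (hT.lt_op_imp_iff (le_right x' y) (le_right x y)).2 ⟨?_, hy⟩⟩
      exact compat_left r x x' y hy hr }

/-! ### Finite limits -/

/-- The terminal object, a single element of full extent. -/
abbrev terminal (hT : T.IsMinimum) : TNormSet.{u} T :=
  ofLevels hT PUnit (fun _ _ => 1) (fun _ _ => rfl) (fun _ _ _ _ h _ => h)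

/-- The morphism to the terminal object. -/
abbrev toTerminal (hT : T.IsMinimum) (X : TNormSet.{u} T) : X ⟶ terminal hT :=
  Hom.ofLevels hT (fun x _ => X.α x x) (fun _ _ _ h => h) (fun _ _ _ _ _ h => X.lt_right h)
    (fun _ _ _ _ h _ => h) (fun _ _ _ _ h _ => h.trans_le unitInterval.le_one')
    (fun _ _ h => ⟨⟨⟩, h⟩)

/-- `terminal` is terminal. -/
noncomputable def isTerminalTerminal (hT : T.IsMinimum) : IsTerminal (terminal.{u} hT) :=
  IsTerminal.ofUniqueHom (toTerminal hT) fun _ f => Hom.ext_of_lt hT fun _ _ _ h => f.lt_left h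

/-- The product of two `[0,1]_*`-sets. -/
abbrev binaryProduct (hT : T.IsMinimum) (X Y : TNormSet.{u} T) : TNormSet.{u} T :=
  ofLevels hT (X.carrier × Y.carrier) (fun a b => min (X.α a.1 b.1) (Y.α a.2 b.2))
    (fun a b => by rw [X.symm, Y.symm]) (fun r a b c h h' => by
      rw [lt_min_iff] at *
      exact ⟨X.lt_trans hT h.1 h'.1, Y.lt_trans hT h.2 h'.2⟩)

section binaryProduct

variable (hT : T.IsMinimum) (X Y : TNormSet.{u} T)

/-- The first projection. -/
abbrev binaryProduct.fst : binaryProduct hT X Y ⟶ X :=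
  Hom.ofLevels hT (fun a x => min (X.α a.1 x) (Y.α a.2 a.2))
    (fun r a x h => by
      rw [lt_min_iff] at *
      exact ⟨X.lt_left h.1, h.2⟩)
    (fun r a b x h h' => by
      rw [lt_min_iff] at *
      exact ⟨X.lt_trans hT (X.lt_symm h'.1) h.1, Y.lt_right h'.2⟩)
    (fun r a x x' h h' => by
      rw [lt_min_iff] at *
      exact ⟨X.lt_trans hT h.1 h', h.2⟩)
    (fun r a x x' h h' => by
      rw [lt_min_iff] at *
      exact X.lt_trans hT (X.lt_symm h.1) h'.1)
    (fun r a h => ⟨a.1, h⟩)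

/-- The second projection. -/
abbrev binaryProduct.snd : binaryProduct hT X Y ⟶ Y :=
  Hom.ofLevels hT (fun a y => min (X.α a.1 a.1) (Y.α a.2 y))
    (fun r a x h => by
      rw [lt_min_iff] at *
      exact ⟨h.1, Y.lt_left h.2⟩)
    (fun r a b x h h' => by
      rw [lt_min_iff] at *
      exact ⟨X.lt_right h'.1, Y.lt_trans hT (Y.lt_symm h'.2) h.2⟩)
    (fun r a x x' h h' => by
      rw [lt_min_iff] at *
      exact ⟨h.1, Y.lt_trans hT h.2 h'⟩)
    (fun r a x x' h h' => by
      rw [lt_min_iff] at *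
      exact Y.lt_trans hT (Y.lt_symm h.2) h'.2)
    (fun r a h => ⟨a.2, h⟩)

variable {X Y}

/-- The morphism to the product induced by two morphisms. -/
abbrev binaryProduct.lift {Z : TNormSet.{u} T} (f : Z ⟶ X) (g : Z ⟶ Y) :
    Z ⟶ binaryProduct hT X Y :=
  Hom.ofLevels hT (fun z a => min (f.rel z a.1) (g.rel z a.2))
    (fun r z a h => by
      rw [lt_min_iff] at h
      exact f.lt_left h.1)
    (fun r z z' a h h' => by
      rw [lt_min_iff] at *
      exact ⟨f.lt_compat_left hT h.1 h', g.lt_compat_left hT h.2 h'⟩)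
    (fun r z a b h h' => by
      rw [lt_min_iff] at *
      exact ⟨f.lt_compat_right hT h.1 h'.1, g.lt_compat_right hT h.2 h'.2⟩)
    (fun r z a b h h' => by
      rw [lt_min_iff] at *
      exact ⟨f.lt_single hT h.1 h'.1, g.lt_single hT h.2 h'.2⟩)
    (fun r z h => by
      obtain ⟨x, hx⟩ := f.lt_total h
      obtain ⟨y, hy⟩ := g.lt_total h
      exact ⟨(x, y), lt_min hx hy⟩)

variable (X Y) in
/-- `binaryProduct` is a product. -/
noncomputable def binaryProduct.isLimit :
    IsLimit (BinaryFan.mk (binaryProduct.fst hT X Y) (binaryProduct.snd hT X Y)) :=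
  BinaryFan.isLimitMk (fun s => binaryProduct.lift hT s.fst s.snd)
    (fun s => Hom.ext_of_lt hT fun r z x h => by
      obtain ⟨a, h1, h2⟩ := (Hom.lt_comp_iff _ hT _).1 h
      rw [lt_min_iff] at h1 h2
      exact Hom.lt_compat_right _ hT h1.1 h2.1)
    (fun s => Hom.ext_of_lt hT fun r z x h => by
      obtain ⟨a, h1, h2⟩ := (Hom.lt_comp_iff _ hT _).1 h
      rw [lt_min_iff] at h1 h2
      exact Hom.lt_compat_right _ hT h1.2 h2.2)
    (fun s m h1 h2 => Hom.ext_of_lt hT fun r z a h => by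
      have ha := Hom.lt_right _ h
      refine lt_min ?_ ?_
      · rw [← h1]
        exact (Hom.lt_comp_iff _ hT _).2 ⟨a, h, ha⟩
      · rw [← h2]
        exact (Hom.lt_comp_iff _ hT _).2 ⟨a, h, ha⟩)

end binaryProduct

section equalizer

variable (hT : T.IsMinimum) {X Y : TNormSet.{u} T} (f g : X ⟶ Y)

theorem lt_min_iSup_iff {ι : Type*} {a r : unitInterval} {b c : ι → unitInterval} :
    r < min a (⨆ i, min (b i) (c i)) ↔ r < a ∧ ∃ i, r < b i ∧ r < c i := by
  simp only [lt_min_iff, lt_iSup_iff]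

/-- The equalizer of two morphisms: the same elements with a smaller extent. -/
noncomputable abbrev equalizer : TNormSet.{u} T :=
  ofLevels hT X.carrier (fun x x' => min (X.α x x') (⨆ y, min (f.rel x y) (g.rel x y)))
    (fun x x' => by
      refine eq_of_forall_lt_iff fun r => ?_
      rw [lt_min_iSup_iff, lt_min_iSup_iff, X.symm x x']
      -- The supremum mentions x alone; where x and x' are equal at level r, compatibility carries a
      -- common value y from one to the other.
      refine and_congr_right fun h => exists_congr fun y => ?_
      exact ⟨fun h' => ⟨f.lt_compat_left hT h'.1 (X.lt_symm h), g.lt_compat_left hT h'.2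
        (X.lt_symm h)⟩, fun h' => ⟨f.lt_compat_left hT h'.1 h, g.lt_compat_left hT h'.2 h⟩⟩)
    (fun r x y z h h' => by
      rw [lt_min_iff] at *
      exact ⟨X.lt_trans hT h.1 h'.1, h.2⟩)

/-- The inclusion of the equalizer. -/
noncomputable abbrev equalizer.ι : equalizer hT f g ⟶ X :=
  Hom.ofLevels hT (equalizer hT f g).α (fun _ _ _ h => (equalizer hT f g).lt_left h)
    (fun _ _ _ _ h h' => (equalizer hT f g).lt_trans hT ((equalizer hT f g).lt_symm h') h)
    (fun r x y z h h' => by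
      rw [lt_min_iff] at *
      exact ⟨X.lt_trans hT h.1 h', h.2⟩)
    (fun r x y z h h' => by
      rw [lt_min_iff] at *
      exact X.lt_trans hT (X.lt_symm h.1) h'.1)
    (fun _ x h => ⟨x, h⟩)

theorem equalizer.condition : equalizer.ι hT f g ≫ f = equalizer.ι hT f g ≫ g :=
  Hom.ext_of_lt hT fun r x y h => by
    obtain ⟨x', h1, h2⟩ := (Hom.lt_comp_iff _ hT _).1 h
    obtain ⟨h3, y', h4, h5⟩ := lt_min_iSup_iff.1 h1
    refine (Hom.lt_comp_iff _ hT _).2 ⟨x', h1, ?_⟩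
    refine g.lt_compat_right hT (g.lt_compat_left hT h5 h3) ?_
    exact f.lt_single hT (f.lt_compat_left hT h4 h3) h2

variable {f g}

/-- The morphism to the equalizer induced by an equalizing morphism. -/
noncomputable abbrev equalizer.lift {Z : TNormSet.{u} T} (k : Z ⟶ X) (h : k ≫ f = k ≫ g) :
    Z ⟶ equalizer hT f g :=
  Hom.ofLevels hT k.rel (fun _ _ _ h => k.lt_left h) (fun _ _ _ _ h h' => k.lt_compat_left hT h h')
    (fun r x y z h h' => k.lt_compat_right hT h (lt_min_iff.1 h').1)
    (fun r z x x' h1 h2 => by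
      refine lt_min_iSup_iff.2 ⟨k.lt_single hT h1 h2, ?_⟩
      obtain ⟨y, hy⟩ := f.lt_total (k.lt_right h1)
      refine ⟨y, hy, ?_⟩
      -- The value y of f at x is also a value of g at some x'' related to z by k; single-valuedness
      -- of k identifies x'' with x.
      have h3 := (k.lt_comp_iff hT f).2 ⟨x, h1, hy⟩
      rw [h] at h3
      obtain ⟨x'', h4, h5⟩ := (k.lt_comp_iff hT g).1 h3
      exact g.lt_compat_left hT h5 (k.lt_single hT h4 h1))
    (fun r z h => k.lt_total h)

variable (f g) in
theorem hasLimit_parallelPair (hT : T.IsMinimum) : HasLimit (parallelPair f g) :=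
  ⟨⟨_, Fork.IsLimit.mk (Fork.ofι _ (equalizer.condition hT f g))
    (fun s => equalizer.lift hT s.ι s.condition)
    (fun s => Hom.ext_of_lt hT fun r z x h => by
      obtain ⟨x', h1, h2⟩ := (Hom.lt_comp_iff _ hT _).1 h
      exact Hom.lt_compat_right _ hT h1 (lt_min_iff.1 h2).1)
    (fun s m hm => Hom.ext_of_lt hT fun r z x h => by
      change r < s.ι.rel z x
      rw [← hm]
      exact (Hom.lt_comp_iff _ hT _).2 ⟨x, h, Hom.lt_right _ h⟩)⟩⟩

end equalizer

theorem hasFiniteLimits (hT : T.IsMinimum) : HasFiniteLimits (TNormSet.{u} T) := by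
  have := (isTerminalTerminal.{u} hT).hasTerminal
  have : HasBinaryProducts (TNormSet.{u} T) :=
    have (X Y : TNormSet.{u} T) : HasLimit (pair X Y) := ⟨⟨_, binaryProduct.isLimit hT X Y⟩⟩
    hasBinaryProducts_of_hasLimit_pair _
  have := hasFiniteProducts_of_has_binary_and_terminal (C := TNormSet.{u} T)
  have : HasEqualizers (TNormSet.{u} T) :=
    have {X Y : TNormSet.{u} T} {f g : X ⟶ Y} := hasLimit_parallelPair f g hT
    hasEqualizers_of_hasLimit_parallelPair _
  exact hasFiniteLimits_of_hasEqualizers_and_finite_products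

end TNormSet

/-! ### Exponentials -/

/-- `- ⨯ Y` is a left adjoint as soon as, for some choice of products with `Y`, every object has a
cofree object. -/
theorem isLeftAdjoint_prod_of_existsUnique {C : Type u} [Category.{v} C] [HasBinaryProducts C]
    (Y : C) {P : C → C} {p₁ : ∀ Z, P Z ⟶ Z} {p₂ : ∀ Z, P Z ⟶ Y}
    (hP : ∀ Z, IsLimit (BinaryFan.mk (p₁ Z) (p₂ Z)))
    (h : ∀ A, ∃ (E : C) (ev : P E ⟶ A), ∀ (Z : C) (g : P Z ⟶ A),
      ∃! k : Z ⟶ E, (hP E).lift (BinaryFan.mk (p₁ Z ≫ k) (p₂ Z)) ≫ ev = g) :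
    (prod.functor.flip.obj Y).IsLeftAdjoint := by
  refine isLeftAdjoint_iff_hasTerminal_costructuredArrow.2 fun A => ?_
  obtain ⟨E, ev, hE⟩ := h A
  let i : ∀ Z, Z ⨯ Y ≅ P Z := fun Z => (prodIsProd Z Y).conePointUniqueUpToIso (hP Z)
  have hi₁ : ∀ Z, (i Z).hom ≫ p₁ Z = prod.fst := fun Z =>
    (prodIsProd Z Y).conePointUniqueUpToIso_hom_comp (hP Z) ⟨.left⟩
  have hi₂ : ∀ Z, (i Z).hom ≫ p₂ Z = prod.snd := fun Z =>
    (prodIsProd Z Y).conePointUniqueUpToIso_hom_comp (hP Z) ⟨.right⟩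
  have hl₁ : ∀ {Z} (k : Z ⟶ E),
      (hP E).lift (BinaryFan.mk (p₁ Z ≫ k) (p₂ Z)) ≫ p₁ E = p₁ Z ≫ k := fun k =>
    (hP E).fac _ ⟨.left⟩
  have hl₂ : ∀ {Z} (k : Z ⟶ E),
      (hP E).lift (BinaryFan.mk (p₁ Z ≫ k) (p₂ Z)) ≫ p₂ E = p₂ Z := fun k =>
    (hP E).fac _ ⟨.right⟩
  have hext : ∀ {W} {a b : W ⟶ P E}, a ≫ p₁ E = b ≫ p₁ E → a ≫ p₂ E = b ≫ p₂ E → a = b :=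
    fun h₁ h₂ => BinaryFan.IsLimit.hom_ext (hP E) h₁ h₂
  have hnat : ∀ {Z} (k : Z ⟶ E), prod.map k (𝟙 Y) ≫ (i E).hom =
      (i Z).hom ≫ (hP E).lift (BinaryFan.mk (p₁ Z ≫ k) (p₂ Z)) := fun k => by
    refine hext ?_ ?_
    · rw [Category.assoc, Category.assoc, hi₁, hl₁, prod.map_fst, ← Category.assoc, hi₁]
    · rw [Category.assoc, Category.assoc, hi₂, hl₂, hi₂, prod.map_snd, Category.comp_id]
  -- This translates the universal property for the products P into the one for `⨯`, so that the
  -- cofree object is terminal among the costructured arrows.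
  have hiff : ∀ {Z} (k : Z ⟶ E) (g : Z ⨯ Y ⟶ A), prod.map k (𝟙 Y) ≫ (i E).hom ≫ ev = g ↔
      (hP E).lift (BinaryFan.mk (p₁ Z ≫ k) (p₂ Z)) ≫ ev = (i Z).inv ≫ g := fun k g => by
    rw [← Category.assoc, hnat, Category.assoc, Iso.eq_inv_comp]
  choose k hk hk' using hE
  refine IsTerminal.hasTerminal (X := CostructuredArrow.mk (S := prod.functor.flip.obj Y) (Y := E)
    (T := A) ((i E).hom ≫ ev)) (IsTerminal.ofUniqueHom
    (fun W => CostructuredArrow.homMk (k W.left ((i W.left).inv ≫ W.hom)) ?_) fun W m => ?_)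
  · exact (hiff _ _).2 (hk _ _)
  · ext
    exact hk' _ _ _ ((hiff _ _).1 (CostructuredArrow.w m))

namespace TNormSet

variable {T : ContinuousTNorm}

/-- A functional relation `X → Y` defined up to some degree. -/
structure PartialHom (X Y : TNormSet.{u} T) : Type u where
  extent : unitInterval
  rel : X.carrier → Y.carrier → unitInterval
  lt_extent : ∀ r x y, r < rel x y → r < extent
  lt_left : ∀ r x y, r < rel x y → r < X.α x x
  lt_compat_left : ∀ r x x' y, r < rel x y → r < X.α x x' → r < rel x' y
  lt_compat_right : ∀ r x y y', r < rel x y → r < Y.α y y' → r < rel x y'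
  lt_single : ∀ r x y y', r < rel x y → r < rel x y' → r < Y.α y y'
  lt_total : ∀ r x, r < extent → r < X.α x x → ∃ y, r < rel x y

/-- Agreement of relations up to the degree `s`. -/
def AgreeBelow {X Y : Type u} (s : unitInterval) (φ ψ : X → Y → unitInterval) : Prop :=
  ∀ r < s, ∀ x y, r < φ x y ↔ r < ψ x y

namespace AgreeBelow

variable {X Y : Type u} {s s' : unitInterval} {φ ψ χ : X → Y → unitInterval}

theorem symm (h : AgreeBelow s φ ψ) : AgreeBelow s ψ φ := fun r hr x y => (h r hr x y).symm

theorem trans (h : AgreeBelow s φ ψ) (h' : AgreeBelow s ψ χ) : AgreeBelow s φ χ :=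
  fun r hr x y => (h r hr x y).trans (h' r hr x y)

theorem mono (h : AgreeBelow s φ ψ) (hs : s' ≤ s) : AgreeBelow s' φ ψ :=
  fun r hr => h r (hr.trans_le hs)

end AgreeBelow

section exponential

variable (hT : T.IsMinimum) (X Y : TNormSet.{u} T)

/-- The exponential `Y ^ X`. -/
noncomputable abbrev exponential : TNormSet.{u} T :=
  ofLevels hT (PartialHom X Y)
    -- Bounding s by both extents makes the self-equality of v its extent; otherwise v would agree
    -- with itself to degree 1.
    (fun v w => sSup {s | s ≤ v.extent ∧ s ≤ w.extent ∧ AgreeBelow s v.rel w.rel})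
    (fun v w => congrArg sSup (Set.ext fun s =>
      ⟨fun h => ⟨h.2.1, h.1, h.2.2.symm⟩, fun h => ⟨h.2.1, h.1, h.2.2.symm⟩⟩))
    (fun r u v w h h' => by
      obtain ⟨s, ⟨h1, h2, h3⟩, hs⟩ := lt_sSup_iff.1 h
      obtain ⟨s', ⟨h1', h2', h3'⟩, hs'⟩ := lt_sSup_iff.1 h'
      exact lt_sSup_iff.2 ⟨min s s', ⟨(min_le_left _ _).trans h1, (min_le_right _ _).trans h2',
        (h3.mono (min_le_left _ _)).trans (h3'.mono (min_le_right _ _))⟩, lt_min hs hs'⟩)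

variable {X Y} in
theorem exponential.lt_α_self {r : unitInterval} {w : PartialHom X Y} :
    r < (exponential hT X Y).α w w ↔ r < w.extent := by
  refine lt_sSup_iff.trans ⟨?_, fun h => ⟨_, ⟨le_rfl, le_rfl, fun _ _ _ _ => Iff.rfl⟩, h⟩⟩
  rintro ⟨s, hs, h⟩
  exact h.trans_le hs.1

/-- The evaluation morphism. -/
noncomputable abbrev exponential.eval : binaryProduct hT (exponential hT X Y) X ⟶ Y :=
  Hom.ofLevels hT (fun a y => a.1.rel a.2 y)
    (fun r a y h => lt_min ((lt_α_self hT).2 (a.1.lt_extent r _ _ h)) (a.1.lt_left r _ _ h))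
    (fun r a b y h h' => by
      rw [lt_min_iff] at h'
      obtain ⟨s, ⟨-, -, h3⟩, hs⟩ := lt_sSup_iff.1 h'.1
      exact b.1.lt_compat_left r _ _ _ ((h3 r hs _ _).1 h) h'.2)
    (fun r a y y' h h' => a.1.lt_compat_right r _ _ _ h h')
    (fun r a y y' h h' => a.1.lt_single r _ _ _ h h')
    (fun r a h => by
      rw [lt_min_iff] at h
      exact a.1.lt_total r _ ((lt_α_self hT).1 h.1) h.2)

variable {X Y} {Z : TNormSet.{u} T}

/-- The section at `z` of a morphism out of a product. -/
abbrev PartialHom.ofHom (g : binaryProduct hT Z X ⟶ Y) (z : Z.carrier) : PartialHom X Y where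
  extent := Z.α z z
  rel x y := g.rel (z, x) y
  lt_extent _ _ _ h := (lt_min_iff.1 (g.lt_left h)).1
  lt_left _ _ _ h := (lt_min_iff.1 (g.lt_left h)).2
  lt_compat_left _ _ _ _ h h' :=
    g.lt_compat_left hT h (lt_min (lt_min_iff.1 (g.lt_left h)).1 h')
  lt_compat_right _ _ _ _ h h' := g.lt_compat_right hT h h'
  lt_single _ _ _ _ h h' := g.lt_single hT h h'
  lt_total _ _ h h' := g.lt_total (lt_min h h')

/-- The transpose of a morphism out of a product. -/
noncomputable abbrev exponential.curry (g : binaryProduct hT Z X ⟶ Y) : Z ⟶ exponential hT X Y :=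
  Hom.ofLevels hT (fun z w => sSup {s | s ≤ Z.α z z ∧ s ≤ w.extent ∧
      AgreeBelow s (fun x y => g.rel (z, x) y) w.rel})
    (fun r z w h => by
      obtain ⟨s, hs, h⟩ := lt_sSup_iff.1 h
      exact h.trans_le hs.1)
    (fun r z z' w h h' => by
      obtain ⟨s, ⟨h1, h2, h3⟩, hs⟩ := lt_sSup_iff.1 h
      -- The sections of g at z and z' agree only below the degree to which z and z' are equal.
      refine lt_sSup_iff.2 ⟨min s (Z.α z z'), ⟨(min_le_right _ _).trans (Z.le_right z z'),
        (min_le_left _ _).trans h2, fun t ht x y => ?_⟩, lt_min hs h'⟩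
      rw [lt_min_iff] at ht
      rw [← h3 t ht.1]
      exact ⟨fun h => g.lt_compat_left hT h
          (lt_min (Z.lt_symm ht.2) (lt_min_iff.1 (g.lt_left h)).2),
        fun h => g.lt_compat_left hT h (lt_min ht.2 (lt_min_iff.1 (g.lt_left h)).2)⟩)
    (fun r z v w h h' => by
      obtain ⟨s, ⟨h1, h2, h3⟩, hs⟩ := lt_sSup_iff.1 h
      obtain ⟨s', ⟨h1', h2', h3'⟩, hs'⟩ := lt_sSup_iff.1 h'
      exact lt_sSup_iff.2 ⟨min s s', ⟨(min_le_left _ _).trans h1, (min_le_right _ _).trans h2',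
        (h3.mono (min_le_left _ _)).trans (h3'.mono (min_le_right _ _))⟩, lt_min hs hs'⟩)
    (fun r z v w h h' => by
      obtain ⟨s, ⟨h1, h2, h3⟩, hs⟩ := lt_sSup_iff.1 h
      obtain ⟨s', ⟨h1', h2', h3'⟩, hs'⟩ := lt_sSup_iff.1 h'
      exact lt_sSup_iff.2 ⟨min s s', ⟨(min_le_left _ _).trans h2, (min_le_right _ _).trans h2',
        (h3.mono (min_le_left _ _)).symm.trans (h3'.mono (min_le_right _ _))⟩, lt_min hs hs'⟩)
    (fun r z h => ⟨PartialHom.ofHom hT g z, lt_sSup_iff.2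
      ⟨Z.α z z, ⟨le_rfl, le_rfl, fun _ _ _ _ => Iff.rfl⟩, h⟩⟩)

/-- Compatibility moves the intermediate element of the product to one with second component `a.2`,
which leaves only w to be quantified. -/
theorem exponential.lt_map_eval_iff (k : Z ⟶ exponential hT X Y) {r : unitInterval}
    {a : (binaryProduct hT Z X).carrier} {y : Y.carrier} :
    r < (binaryProduct.lift hT (binaryProduct.fst hT Z X ≫ k) (binaryProduct.snd hT Z X) ≫
      exponential.eval hT X Y).rel a y ↔ ∃ w, r < k.rel a.1 w ∧ r < w.rel a.2 y := by
  rw [Hom.lt_comp_iff _ hT]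
  simp only [lt_min_iff, Hom.lt_comp_iff _ hT]
  constructor
  · rintro ⟨⟨w, x⟩, ⟨⟨z, ⟨h1, -⟩, h3⟩, -, h4⟩, h5⟩
    exact ⟨w, k.lt_compat_left hT h3 (Z.lt_symm h1), w.lt_compat_left r _ _ _ h5 (X.lt_symm h4)⟩
  · rintro ⟨w, h1, h2⟩
    have hx := w.lt_left r _ _ h2
    have hz := k.lt_left h1
    exact ⟨(w, a.2), ⟨⟨a.1, ⟨hz, hx⟩, h1⟩, hz, hx⟩, h2⟩

theorem exponential.map_curry_eval (g : binaryProduct hT Z X ⟶ Y) :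
    binaryProduct.lift hT (binaryProduct.fst hT Z X ≫ exponential.curry hT g)
      (binaryProduct.snd hT Z X) ≫ exponential.eval hT X Y = g :=
  Hom.ext_of_lt hT fun r a y h => by
    obtain ⟨w, h1, h2⟩ := (exponential.lt_map_eval_iff hT _).1 h
    obtain ⟨s, ⟨-, -, h3⟩, hs⟩ := lt_sSup_iff.1 h1
    exact (h3 r hs _ _).2 h2

theorem exponential.eq_curry (k : Z ⟶ exponential hT X Y) :
    k = exponential.curry hT (binaryProduct.lift hT (binaryProduct.fst hT Z X ≫ k)
      (binaryProduct.snd hT Z X) ≫ exponential.eval hT X Y) :=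
  Hom.ext_of_lt hT fun r z w h => by
    -- Below the degree `k.rel z w`, any other value w' of k at z equals w by single-valuedness, so
    -- w is the section at z.
    refine lt_sSup_iff.2 ⟨k.rel z w, ⟨k.rel_le_left z w,
      le_of_forall_lt fun t ht => (exponential.lt_α_self hT).1 (k.lt_right ht),
      fun t ht x y => ?_⟩, h⟩
    rw [exponential.lt_map_eval_iff]
    refine ⟨?_, fun h => ⟨w, ht, h⟩⟩
    rintro ⟨w', h1, h2⟩
    obtain ⟨s, ⟨-, -, h3⟩, hs⟩ := lt_sSup_iff.1 (k.lt_single hT h1 ht)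
    exact (h3 t hs _ _).1 h2

end exponential

theorem isLeftAdjoint_prod (hT : T.IsMinimum) [HasBinaryProducts (TNormSet.{u} T)]
    (X : TNormSet.{u} T) : (prod.functor.flip.obj X).IsLeftAdjoint :=
  isLeftAdjoint_prod_of_existsUnique X (fun Z => binaryProduct.isLimit hT Z X) fun Y =>
    ⟨exponential hT X Y, exponential.eval hT X Y, fun Z g =>
      ⟨exponential.curry hT g, exponential.map_curry_eval hT g, fun k hk => by
        rw [← hk]
        exact exponential.eq_curry hT k⟩⟩

/-! ### Subobject classifier -/

/-- The one-element `[0,1]_*`-set of extent `d`. -/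
abbrev onePoint (hT : T.IsMinimum) (d : unitInterval) : TNormSet.{u} T :=
  ofLevels hT PUnit (fun _ _ => d) (fun _ _ => rfl) (fun _ _ _ _ h _ => h)

/-- The restriction of an element to a smaller extent. -/
abbrev restrict (hT : T.IsMinimum) {X : TNormSet.{u} T} (x : X.carrier) {d : unitInterval}
    (hd : d ≤ X.α x x) : onePoint.{u} hT d ⟶ X :=
  Hom.ofLevels hT (fun _ x' => min (X.α x x') d) (fun _ _ _ h => (lt_min_iff.1 h).2)
    (fun _ _ _ _ h _ => h)
    (fun _ _ _ _ h h' => lt_min (X.lt_trans hT (lt_min_iff.1 h).1 h') (lt_min_iff.1 h).2)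
    (fun _ _ _ _ h h' => X.lt_trans hT (X.lt_symm (lt_min_iff.1 h).1) (lt_min_iff.1 h').1)
    (fun _ _ h => ⟨x, lt_min (h.trans_le hd) h⟩)

/-- Monomorphisms are injective at every level. -/
theorem lt_of_mono (hT : T.IsMinimum) {U X : TNormSet.{u} T} (m : U ⟶ X) [Mono m]
    {r : unitInterval} {u u' : U.carrier} {x : X.carrier} (h : r < m.rel u x) (h' : r < m.rel u' x) :
    r < U.α u u' := by
  have hd := min_le_left (m.rel u x) (m.rel u' x)
  have hd' := min_le_right (m.rel u x) (m.rel u' x)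
  -- With d the smaller of the two degrees, the restrictions of u and u' to extent d are both sent
  -- by m to the restriction of x, so m identifies them.
  have heq : restrict hT u (hd.trans (m.rel_le_left u x)) =
      restrict hT u' (hd'.trans (m.rel_le_left u' x)) := by
    rw [← cancel_mono m]
    refine Hom.ext_of_lt hT fun t _ x' ht => ?_
    obtain ⟨v, h1, h2⟩ := (Hom.lt_comp_iff _ hT m).1 ht
    rw [lt_min_iff] at h1
    have h3 := m.lt_single hT (h1.2.trans_le hd) (m.lt_compat_left hT h2 (U.lt_symm h1.1))
    have h4 := h1.2.trans_le hd'
    exact (Hom.lt_comp_iff _ hT m).2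
      ⟨u', lt_min (m.lt_left h4) h1.2, m.lt_compat_right hT h4 h3⟩
  have h1 : r < (restrict hT u' (hd'.trans (m.rel_le_left u' x))).rel ⟨⟩ u' :=
    lt_min (m.lt_left h') (lt_min h h')
  rw [← heq] at h1
  exact (lt_min_iff.1 h1).1

variable (hT : T.IsMinimum)

/-- The object of truth values. -/
noncomputable abbrev truthValues : TNormSet.{u} T :=
  -- This is the Heyting equivalence: 1 if p = q and min p q otherwise. All truth values have extent
  -- 1.
  ofLevels hT (ULift unitInterval) (fun p q => sSup {s | ∀ r < s, r < p.down ↔ r < q.down})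
    (fun p q => by simp only [iff_comm])
    (fun r p q q' h h' => by
      obtain ⟨s, h1, hs⟩ := lt_sSup_iff.1 h
      obtain ⟨s', h1', hs'⟩ := lt_sSup_iff.1 h'
      refine lt_sSup_iff.2 ⟨min s s', fun t ht => ?_, lt_min hs hs'⟩
      rw [lt_min_iff] at ht
      exact (h1 t ht.1).trans (h1' t ht.2))

/-- The truth value `1`. -/
noncomputable abbrev truth : terminal.{u} hT ⟶ truthValues.{u} hT :=
  -- The degree to which p equals 1 is p itself.
  Hom.ofLevels hT (fun _ p => p.down) (fun _ _ _ h => h.trans_le unitInterval.le_one')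
    (fun _ _ _ _ h _ => h)
    (fun r _ p q h h' => by
      obtain ⟨s, h1, hs⟩ := lt_sSup_iff.1 h'
      exact (h1 r hs).1 h)
    (fun r _ p q h h' => lt_sSup_iff.2 ⟨min p.down q.down, fun t ht =>
      iff_of_true (lt_min_iff.1 ht).1 (lt_min_iff.1 ht).2, lt_min h h'⟩)
    (fun _ _ h => ⟨⟨1⟩, h⟩)

theorem lt_toTerminal_truth_iff {X : TNormSet.{u} T} (f : X ⟶ terminal hT) {r : unitInterval}
    {x : X.carrier} {p : (truthValues.{u} hT).carrier} :
    r < (f ≫ truth hT).rel x p ↔ r < X.α x x ∧ r < p.down := by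
  rw [(isTerminalTerminal hT).hom_ext f (toTerminal hT X), Hom.lt_comp_iff _ hT]
  exact ⟨fun ⟨_, h⟩ => h, fun h => ⟨⟨⟩, h⟩⟩

section classify

variable {U X : TNormSet.{u} T} (m : U ⟶ X)

/-- The characteristic morphism of a subobject. -/
noncomputable abbrev classify : X ⟶ truthValues.{u} hT :=
  -- The degree to which p is the truth value ⨆ u, m(u, x) of x belonging to the subobject, cut down
  -- to the extent of x.
  Hom.ofLevels hT (fun x p => sSup {s | s ≤ X.α x x ∧ ∀ r < s, (∃ u, r < m.rel u x) ↔ r < p.down})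
    (fun r x p h => by
      obtain ⟨s, hs, h⟩ := lt_sSup_iff.1 h
      exact h.trans_le hs.1)
    (fun r x x' p h h' => by
      obtain ⟨s, ⟨h1, h2⟩, hs⟩ := lt_sSup_iff.1 h
      refine lt_sSup_iff.2 ⟨min s (X.α x x'), ⟨(min_le_right _ _).trans (X.le_right x x'),
        fun t ht => ?_⟩, lt_min hs h'⟩
      rw [lt_min_iff] at ht
      rw [← h2 t ht.1]
      exact exists_congr fun u => ⟨fun h => m.lt_compat_right hT h (X.lt_symm ht.2),
        fun h => m.lt_compat_right hT h ht.2⟩)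
    (fun r x p q h h' => by
      obtain ⟨s, ⟨h1, h2⟩, hs⟩ := lt_sSup_iff.1 h
      obtain ⟨s', h1', hs'⟩ := lt_sSup_iff.1 h'
      refine lt_sSup_iff.2 ⟨min s s', ⟨(min_le_left _ _).trans h1, fun t ht => ?_⟩, lt_min hs hs'⟩
      rw [lt_min_iff] at ht
      exact (h2 t ht.1).trans (h1' t ht.2))
    (fun r x p q h h' => by
      obtain ⟨s, ⟨-, h2⟩, hs⟩ := lt_sSup_iff.1 h
      obtain ⟨s', ⟨-, h2'⟩, hs'⟩ := lt_sSup_iff.1 h'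
      refine lt_sSup_iff.2 ⟨min s s', fun t ht => ?_, lt_min hs hs'⟩
      rw [lt_min_iff] at ht
      exact (h2 t ht.1).symm.trans (h2' t ht.2))
    (fun r x h => ⟨⟨⨆ u, m.rel u x⟩, lt_sSup_iff.2
      ⟨_, ⟨le_rfl, fun t _ => lt_iSup_iff.symm⟩, h⟩⟩)

theorem comp_classify : m ≫ classify hT m = toTerminal hT U ≫ truth hT :=
  Hom.ext_of_lt hT fun r u p h => by
    obtain ⟨x, h1, h2⟩ := (m.lt_comp_iff hT _).1 h
    obtain ⟨s, ⟨-, h3⟩, hs⟩ := lt_sSup_iff.1 h2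
    exact (lt_toTerminal_truth_iff hT _).2 ⟨m.lt_left h1, (h3 r hs).1 ⟨u, h1⟩⟩

/-- A morphism classified as true meets the subobject. -/
theorem exists_lt_of_comp_classify {Z : TNormSet.{u} T} {f : Z ⟶ X} {t : Z ⟶ terminal hT}
    (hf : f ≫ classify hT m = t ≫ truth hT) {r : unitInterval} {z : Z.carrier} {x : X.carrier}
    (h : r < f.rel z x) : ∃ u, r < m.rel u x := by
  obtain ⟨p, hp⟩ := (classify hT m).lt_total (f.lt_right h)
  have h1 := (f.lt_comp_iff hT _).2 ⟨x, h, hp⟩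
  rw [hf, lt_toTerminal_truth_iff] at h1
  obtain ⟨s, ⟨-, h3⟩, hs⟩ := lt_sSup_iff.1 hp
  exact (h3 r hs).2 h1.2

theorem eq_classify {t : U ⟶ terminal hT} {χ : X ⟶ truthValues.{u} hT}
    (h : IsPullback m t χ (truth hT)) : χ = classify hT m :=
  Hom.ext_of_lt hT fun r x p hr => by
    refine lt_sSup_iff.2 ⟨χ.rel x p, ⟨χ.rel_le_left x p, fun t ht => ⟨?_, fun htp => ?_⟩⟩, hr⟩
    · rintro ⟨u, hu⟩
      have h1 := (m.lt_comp_iff hT χ).2 ⟨x, hu, ht⟩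
      rw [h.w, lt_toTerminal_truth_iff] at h1
      exact h1.2
    -- On the restriction of x to this extent χ takes the value true, so the restriction factors
    -- through m and yields the required u.
    · have hd : min p.down (χ.rel x p) ≤ X.α x x := (min_le_right _ _).trans (χ.rel_le_left x p)
      have hw : restrict hT x hd ≫ χ = toTerminal hT _ ≫ truth hT :=
        Hom.ext_of_lt hT fun t' a q h' => by
          obtain ⟨x', h1, h2⟩ := (Hom.lt_comp_iff _ hT χ).1 h'
          simp only [lt_min_iff] at h1
          refine (lt_toTerminal_truth_iff hT _).2 ⟨lt_min h1.2.1 h1.2.2, ?_⟩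
          obtain ⟨s, h3, hs⟩ := lt_sSup_iff.1
            (χ.lt_single hT h1.2.2 (χ.lt_compat_left hT h2 (X.lt_symm h1.1)))
          exact (h3 t' hs).1 h1.2.1
      have h1 : t < (restrict hT x hd).rel ⟨⟩ x := lt_min (χ.lt_left ht) (lt_min htp ht)
      rw [← h.lift_fst _ _ hw] at h1
      obtain ⟨u, -, hu⟩ := (Hom.lt_comp_iff _ hT m).1 h1
      exact ⟨u, hu⟩

variable [Mono m]

/-- The factorization through a subobject of a morphism classified as true. -/
noncomputable abbrev factor {Z : TNormSet.{u} T} {f : Z ⟶ X} {t : Z ⟶ terminal hT}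
    (hf : f ≫ classify hT m = t ≫ truth hT) : Z ⟶ U :=
  have hlt : ∀ {r z u}, r < ⨆ x, min (f.rel z x) (m.rel u x) ↔
      ∃ x, r < f.rel z x ∧ r < m.rel u x := by
    simp only [lt_iSup_iff, lt_min_iff, implies_true]
  -- This is f followed by the converse of m: single-valued because m is mono, total because f is
  -- classified as true.
  Hom.ofLevels hT (fun z u => ⨆ x, min (f.rel z x) (m.rel u x))
    (fun r z u h => by
      obtain ⟨x, h1, -⟩ := hlt.1 h
      exact f.lt_left h1)
    (fun r z z' u h h' => by
      obtain ⟨x, h1, h2⟩ := hlt.1 h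
      exact hlt.2 ⟨x, f.lt_compat_left hT h1 h', h2⟩)
    (fun r z u u' h h' => by
      obtain ⟨x, h1, h2⟩ := hlt.1 h
      exact hlt.2 ⟨x, h1, m.lt_compat_left hT h2 h'⟩)
    (fun r z u u' h h' => by
      obtain ⟨x, h1, h2⟩ := hlt.1 h
      obtain ⟨x', h1', h2'⟩ := hlt.1 h'
      exact lt_of_mono hT m (m.lt_compat_right hT h2 (f.lt_single hT h1 h1')) h2')
    (fun r z h => by
      obtain ⟨x, hx⟩ := f.lt_total h
      obtain ⟨u, hu⟩ := exists_lt_of_comp_classify hT m hf hx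
      exact ⟨u, hlt.2 ⟨x, hx, hu⟩⟩)

theorem factor_comp {Z : TNormSet.{u} T} {f : Z ⟶ X} {t : Z ⟶ terminal hT}
    (hf : f ≫ classify hT m = t ≫ truth hT) : factor hT m hf ≫ m = f :=
  Hom.ext_of_lt hT fun r z x h => by
    obtain ⟨u, h1, h2⟩ := (Hom.lt_comp_iff _ hT m).1 h
    obtain ⟨x', h3⟩ := lt_iSup_iff.1 h1
    rw [lt_min_iff] at h3
    exact f.lt_compat_right hT h3.1 (m.lt_single hT h3.2 h2)

theorem isPullback_classify : IsPullback m (toTerminal hT U) (classify hT m) (truth hT) :=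
  IsPullback.of_isLimit' ⟨comp_classify hT m⟩ (PullbackCone.IsLimit.mk _
    (fun s => factor hT m s.condition) (fun s => factor_comp hT m s.condition)
    (fun _ => (isTerminalTerminal hT).hom_ext _ _)
    (fun s l hl _ => by rw [← cancel_mono m, hl, factor_comp]))

end classify

theorem hasSubobjectClassifier (hT : T.IsMinimum) :
    HasSubobjectClassifier (TNormSet.{u} T) :=
  ⟨⟨.mkOfTerminalΩ₀ _ (isTerminalTerminal hT) _ (truth hT) (fun m _ => classify hT m)
    (fun m _ => isPullback_classify hT m) (fun m _ _ h => eq_classify hT m h)⟩⟩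

end TNormSet

theorem ContinuousTNorm.IsMinimum.isTopos {T : ContinuousTNorm} (hT : T.IsMinimum) :
    IsTopos (TNormSet.{u} T) where
  hasFiniteLimits := TNormSet.hasFiniteLimits hT
  exponentiable :=
    have := TNormSet.hasFiniteLimits.{u} hT
    TNormSet.isLeftAdjoint_prod hT
  hasSubobjectClassifier := TNormSet.hasSubobjectClassifier hT

theorem mainTheorem3 (T : ContinuousTNorm) :
    IsTopos (TNormSet.{u} T) ↔ T.IsMinimum :=
  ⟨IsTopos.isMinimum, ContinuousTNorm.IsMinimum.isTopos⟩
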